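/- Let $\mathbb U=\{z\in\mathbb C:|z|<1\}$ and let $\mathcal A$ be the class of functions $f(z)=z+\sum_{n\ge2}a_nz^n$ analytic in $\mathbb U$. For $\delta\ge1$ let $f_\delta(z)=\int_0^z\left(\frac{1+r}{1-r}\right)^{\delta}\frac{dr}{1-r^2}=z+\sum_{n\ge2}b_n(\delta)z^n$, and for $f\in\mathcal A$ let $h_\delta(z)=(f*f_\delta)(z)=z+\sum_{n\ge2}a_nb_n(\delta)z^n$. For $t\in(1/2,1)$ let $G(z)=\frac1{1-2tz+z^2}$. We write $h_\delta\in\mathcal S_\sigma^{\star,\delta}(t)$ if $h_\delta$ is bi-univalent in $\mathbb U$ (that is, $h_\delta$ is univalent in $\mathbb U$ and its inverse near the origin continues analytically to a univalent function $k_\delta$ on $\mathbb U$) and $\frac{zh_\delta'(z)}{h_\delta(z)}\prec G(z)$ and $\frac{wk_\delta'(w)}{k_\delta(w)}\prec G(w)$, where $F\prec G$ means $F=G\circ\omega$ on $\mathbb U$ for some analytic $\omega:\mathbb U\to\mathbb U$ with $\omega(0)=0$. Let $U_n$ be the Chebyshev polynomials of the second kind, and put $$\Omega_{\lambda,\mu,\delta}(t)=18(2\delta^2+1)^2(\lambda+\mu)^3U_3(t)-U_1^3(t)(3\lambda+\mu)\big(3(2\delta^2+1)^2(\mu^2+3\mu-4)+54\delta(\delta^3+2\delta)\big),$$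 $$\begin{aligned}\chi_1={}&(2\lambda+\mu)^2U_1(t)|\Omega_{\lambda,\mu,\delta}(t)|+18(\lambda+\mu)^3\big(3\delta(\delta^3+2\delta)(\lambda+\mu)(3\lambda+\mu)-(2\delta^2+1)^2(2\lambda+\mu)^2\big)U_1^2(t)\\&-9(\lambda+\mu)^2(2\lambda+\mu)U_1(t)\big((3\lambda+\mu)(8\delta^4-4\delta^2+5)U_1^2(t)+4(2\delta^2+1)^2(2\lambda+\mu)(\lambda+\mu)U_2(t)\big),\end{aligned}$$ $$\nabla_{(a,b,c);(d,e,f)}^{(m,n,r)}=m(1+2\delta^2)^2+nt(a+b\delta^2+c\delta^4)+rt^2(d+e\delta^2+f\delta^4),$$ $$\varphi(2^-,t)=\frac{8t^2\big((2\delta^2+1)^2-6t^2(\delta^2-1)^2\big)}{(2\delta^3+\delta)^2(\delta^2+2)},$$ $$\varphi(c_0,t)=\frac{9t^2}{(2\delta^2+1)^2}+\frac{t\big(\nabla_{(-2,10,1);(23,20,56)}^{(-2,-1,1)}\big)^2}{\delta(2\delta^2+1)^2(\delta^3+2\delta)\Big(\nabla_{(4,-2,7);(23,20,56)}^{(-4,1,2)}-8t\left|6t^2(\delta^2-1)^2-(2\delta^2+1)^2\right|\Big)}.$$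 Let $\delta\ge1$. If $11\delta^4-70\delta^2+23<0$, then the equation $\chi_1=0$ with $\lambda=1,\mu=0$ has exactly one root $t_{0_2}$ in $(1/2,1)$. Moreover, for all $t\in(1/2,1)$ and all $f\in\mathcal A$ with $h_\delta\in\mathcal S_\sigma^{\star,\delta}(t)$: whenever $t_{0_2}\in(1/2,1)$ is a root of $\chi_1=0$ with $\lambda=1,\mu=0$, $$|a_2a_4-a_3^2|\le\begin{cases}\varphi(2^-,t),&\tfrac12<t\le t_{0_2},\\ \varphi(c_0,t),&t_{0_2}<t<1;\end{cases}$$ and if $\chi_1=0$ with $\lambda=1,\mu=0$ has no root in $(1/2,1)$, then $|a_2a_4-a_3^2|\le\varphi(c_0,t)$ for all $t\in(1/2,1)$. -/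

import Mathlib

open Set Filter Topology

noncomputable section

namespace BiUniv

/-- The open unit disk. -/
def U : Set ℂ := Metric.ball 0 1

/-- The `n`-th Taylor coefficient of `f` at the origin. -/
def coeff (f : ℂ → ℂ) (n : ℕ) : ℂ := iteratedDeriv n f 0 / (n.factorial : ℂ)

/-- Functions analytic in the unit disk, of the form `z + a₂ z² + a₃ z³ + ⋯`. -/
structure ClassA (f : ℂ → ℂ) : Prop where
  diff : DifferentiableOn ℂ f U
  map_zero : f 0 = 0
  deriv_zero : deriv f 0 = 1

/-- `h` is bi-univalent in the unit disk and `k` is its inverse: `h` is normalized and univalent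
in the disk, and `k` is analytic and univalent in the whole disk and is the inverse of `h` near
the origin (by the identity theorem it is then the analytic continuation to the disk of the local
inverse of `h` fixing the origin). -/
structure IsBiUnivalent (h k : ℂ → ℂ) : Prop where
  normalized : ClassA h
  univalent : InjOn h U
  inv_diff : DifferentiableOn ℂ k U
  inv_univalent : InjOn k U
  inv_zero : k 0 = 0
  right_inv : ∀ᶠ w in 𝓝 (0 : ℂ), h (k w) = w

/-- Subordination `F ≺ G` in the unit disk. -/
def Subordinate (F G : ℂ → ℂ) : Prop :=
  ∃ w : ℂ → ℂ, DifferentiableOn ℂ w U ∧ w 0 = 0 ∧ MapsTo w U U ∧ ∀ z ∈ U, F z = G (w z)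

/-- Generating function `1 / (1 - 2 t z + z²)` of the Chebyshev polynomials of the second kind. -/
def chebyshevGen (t : ℝ) (z : ℂ) : ℂ := 1 / (1 - 2 * (t : ℂ) * z + z ^ 2)

/-- The function `z h'(z) / h(z)`, with its removable singularity at `z = 0` filled in:
`dslope h 0 z` is `h z / z` for `z ≠ 0` when `h 0 = 0`, and `h'(0)` for `z = 0`. -/
def starlikeQuotient (h : ℂ → ℂ) (z : ℂ) : ℂ := deriv h z / dslope h 0 z

/-- The class of bi-univalent `h` with inverse `k` such that `z h'(z) / h(z)` and
`w k'(w) / k(w)` are both subordinate to the Chebyshev generating function. -/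
def BiStarlike (t : ℝ) (h : ℂ → ℂ) : Prop :=
  ∃ k : ℂ → ℂ, IsBiUnivalent h k ∧
    Subordinate (starlikeQuotient h) (chebyshevGen t) ∧
    Subordinate (starlikeQuotient k) (chebyshevGen t)

/-- The function `f_δ(z) = ∫₀ᶻ ((1 + r) / (1 - r))^δ (1 - r²)⁻¹ dr`, integrated along the segment
`r = s z`, `0 ≤ s ≤ 1`; for `z` in the disk the base of the power has positive real part and
the power is the principal one. -/
def fDelta (δ : ℝ) (z : ℂ) : ℂ :=
  z * ∫ s in (0 : ℝ)..1,
    ((1 + (s : ℂ) * z) / (1 - (s : ℂ) * z)) ^ (δ : ℂ) * (1 / (1 - ((s : ℂ) * z) ^ 2))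

/-- Hadamard product (convolution) of two power series. -/
def hadamard (f g : ℂ → ℂ) (z : ℂ) : ℂ := ∑' n : ℕ, coeff f n * coeff g n * z ^ n

/-- Chebyshev polynomials of the second kind, as functions of a real variable. -/
def chebU (n : ℕ) (t : ℝ) : ℝ := (Polynomial.Chebyshev.U ℝ (n : ℤ)).eval t

/-- The quantity `Ω_{λ,μ,δ}(t)` (with `l = λ`, `m = μ`). -/
def Omega (l m δ t : ℝ) : ℝ :=
  18 * (2 * δ ^ 2 + 1) ^ 2 * (l + m) ^ 3 * chebU 3 t
    - chebU 1 t ^ 3 * (3 * l + m) *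
      (3 * (2 * δ ^ 2 + 1) ^ 2 * (m ^ 2 + 3 * m - 4) + 54 * δ * (δ ^ 3 + 2 * δ))

/-- The quantity `χ₁(λ, μ, δ; t)` (with `l = λ`, `m = μ`). -/
def chi1 (l m δ t : ℝ) : ℝ :=
  (2 * l + m) ^ 2 * chebU 1 t * |Omega l m δ t|
    + 18 * (l + m) ^ 3 *
      (3 * δ * (δ ^ 3 + 2 * δ) * (l + m) * (3 * l + m)
        - (2 * δ ^ 2 + 1) ^ 2 * (2 * l + m) ^ 2) * chebU 1 t ^ 2
    - 9 * (l + m) ^ 2 * (2 * l + m) * chebU 1 t *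
      ((3 * l + m) * (8 * δ ^ 4 - 4 * δ ^ 2 + 5) * chebU 1 t ^ 2
        + 4 * (2 * δ ^ 2 + 1) ^ 2 * (2 * l + m) * (l + m) * chebU 2 t)

/-- The abbreviation `∇_{(a,b,c);(d,e,f)}^{(m,n,r)}(δ; t)`. -/
def nabla (m n r a b c d e f δ t : ℝ) : ℝ :=
  m * (1 + 2 * δ ^ 2) ^ 2 + n * t * (a + b * δ ^ 2 + c * δ ^ 4)
    + r * t ^ 2 * (d + e * δ ^ 2 + f * δ ^ 4)

/-- The bound `φ(2⁻, t)`. -/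
def phiTwo (δ t : ℝ) : ℝ :=
  8 * t ^ 2 * ((2 * δ ^ 2 + 1) ^ 2 - 6 * t ^ 2 * (δ ^ 2 - 1) ^ 2)
    / ((2 * δ ^ 3 + δ) ^ 2 * (δ ^ 2 + 2))

/-- The bound `φ(c₀, t)`. -/
def phiCrit (δ t : ℝ) : ℝ :=
  9 * t ^ 2 / (2 * δ ^ 2 + 1) ^ 2
    + t * nabla (-2) (-1) 1 (-2) 10 1 23 20 56 δ t ^ 2
      / (δ * (2 * δ ^ 2 + 1) ^ 2 * (δ ^ 3 + 2 * δ) *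
        (nabla (-4) 1 2 4 (-2) 7 23 20 56 δ t
          - 8 * t * |6 * t ^ 2 * (δ ^ 2 - 1) ^ 2 - (2 * δ ^ 2 + 1) ^ 2|))

end BiUniv

end

open ComplexConjugate

/-! Let `w`, `v` be the Schwarz functions of the two subordinations. Comparing Taylor coefficients
(`coeff_of_subordinate`, `coeff_inverse`) forces `v₁ = -w₁`, and one Schur step (`schwarz_coeff`)
writes `w₂, w₃, v₂, v₃` through `c = w₁` and `x, y, s, s'` in the disk (`exists_parameters`). As `b₂
b₄ = P / 3` and `b₃² = D / 9` with `P = δ²(δ² + 2)`, `D = (2δ² + 1)²`, the number `P D (a₂ a₄ -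
a₃²)` becomes a polynomial in these parameters. The triangle inequality, followed by worst-case `|x|
= |y| = 1` (`majorant_le`), bounds its modulus by a real quadratic in `u = |c|² ∈ [0, 1]`
(`hankel_le`): `9 P t² + 2 t N u - t g(t) u²`, where `N` is the `nabla` in the numerator of
`phiCrit`.

Here `g = gap (δ²)`, and `χ₁ = -72 t g(t)` for `λ = 1`, `μ = 0`. If `g(t) > 0`, completing the
square gives `phiCrit`; if `g(t) ≤ 0`, then `N ≥ 0` makes the quadratic increasing, and its value at
`u = 1` gives `phiTwo`. Since `g` is strictly increasing on `[1/2, 1]` and `g(1) > 0`, it changes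
sign at most once, exactly at a root of `χ₁`. -/

namespace BiUniv

/-! ### Fourth-order jets at the origin -/

/-- The polynomial `a₀ + a₁ z + a₂ z² + a₃ z³ + a₄ z⁴`. -/
def jetPoly (a₀ a₁ a₂ a₃ a₄ z : ℂ) : ℂ := a₀ + a₁ * z + a₂ * z ^ 2 + a₃ * z ^ 3 + a₄ * z ^ 4

/-- `f` agrees with `a₀ + a₁ z + a₂ z² + a₃ z³ + a₄ z⁴` up to `O(z⁵)` at the origin. -/
def HasJet (f : ℂ → ℂ) (a₀ a₁ a₂ a₃ a₄ : ℂ) : Prop :=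
  (fun z => f z - jetPoly a₀ a₁ a₂ a₃ a₄ z) =O[𝓝 0] fun z : ℂ => z ^ 5

lemma isBigO_pow_mul_of_continuous (n : ℕ) {g : ℂ → ℂ} (hg : Continuous g) :
    (fun z => z ^ n * g z) =O[𝓝 0] fun z : ℂ => z ^ n := by
  simpa using (Asymptotics.isBigO_refl (fun z : ℂ => z ^ n) (𝓝 0)).mul
    ((hg.continuousAt (x := (0 : ℂ))).isBigO_one ℂ)

lemma HasJet.isBigO_one {f : ℂ → ℂ} {a₀ a₁ a₂ a₃ a₄ : ℂ} (hf : HasJet f a₀ a₁ a₂ a₃ a₄) :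
    f =O[𝓝 0] fun _ => (1 : ℂ) := by
  have h1 : (fun z : ℂ => z ^ 5) =O[𝓝 0] fun _ => (1 : ℂ) :=
    ((continuous_pow 5).continuousAt (x := (0 : ℂ))).isBigO_one ℂ
  have h2 : (jetPoly a₀ a₁ a₂ a₃ a₄) =O[𝓝 0] fun _ => (1 : ℂ) := by
    have : Continuous (jetPoly a₀ a₁ a₂ a₃ a₄) := by unfold jetPoly; fun_prop
    exact (this.continuousAt (x := (0 : ℂ))).isBigO_one ℂ
  simpa using (hf.trans h1).add h2

lemma HasJet.congr {f g : ℂ → ℂ} {a₀ a₁ a₂ a₃ a₄ : ℂ} (hf : HasJet f a₀ a₁ a₂ a₃ a₄)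
    (h : f =ᶠ[𝓝 0] g) : HasJet g a₀ a₁ a₂ a₃ a₄ :=
  Asymptotics.IsBigO.congr' hf (h.mono fun z hz => by simp [hz]) EventuallyEq.rfl

lemma HasJet.add {f g : ℂ → ℂ} {a₀ a₁ a₂ a₃ a₄ b₀ b₁ b₂ b₃ b₄ : ℂ}
    (hf : HasJet f a₀ a₁ a₂ a₃ a₄) (hg : HasJet g b₀ b₁ b₂ b₃ b₄) :
    HasJet (fun z => f z + g z) (a₀ + b₀) (a₁ + b₁) (a₂ + b₂) (a₃ + b₃) (a₄ + b₄) := by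
  refine (Asymptotics.IsBigO.add hf hg).congr_left fun z => ?_
  simp only [jetPoly]; ring

lemma HasJet.mul {f g : ℂ → ℂ} {a₀ a₁ a₂ a₃ a₄ b₀ b₁ b₂ b₃ b₄ : ℂ}
    (hf : HasJet f a₀ a₁ a₂ a₃ a₄) (hg : HasJet g b₀ b₁ b₂ b₃ b₄) :
    HasJet (fun z => f z * g z) (a₀ * b₀) (a₀ * b₁ + a₁ * b₀) (a₀ * b₂ + a₁ * b₁ + a₂ * b₀)
      (a₀ * b₃ + a₁ * b₂ + a₂ * b₁ + a₃ * b₀)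
      (a₀ * b₄ + a₁ * b₃ + a₂ * b₂ + a₃ * b₁ + a₄ * b₀) := by
  have h1 : (fun z => f z * (g z - jetPoly b₀ b₁ b₂ b₃ b₄ z)) =O[𝓝 0] fun z : ℂ => z ^ 5 := by
    simpa using hf.isBigO_one.mul hg
  have hp : Continuous (jetPoly b₀ b₁ b₂ b₃ b₄) := by unfold jetPoly; fun_prop
  have h2 : (fun z => (f z - jetPoly a₀ a₁ a₂ a₃ a₄ z) * jetPoly b₀ b₁ b₂ b₃ b₄ z)
      =O[𝓝 0] fun z : ℂ => z ^ 5 := by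
    simpa using Asymptotics.IsBigO.mul hf ((hp.continuousAt (x := (0 : ℂ))).isBigO_one ℂ)
  have h3 := isBigO_pow_mul_of_continuous 5
    (g := fun z => (a₁ * b₄ + a₂ * b₃ + a₃ * b₂ + a₄ * b₁) + (a₂ * b₄ + a₃ * b₃ + a₄ * b₂) * z
      + (a₃ * b₄ + a₄ * b₃) * z ^ 2 + a₄ * b₄ * z ^ 3) (by fun_prop)
  refine ((h1.add h2).add h3).congr_left fun z => ?_
  simp only [jetPoly]; ring

lemma HasJet.const (c : ℂ) : HasJet (fun _ => c) c 0 0 0 0 := by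
  refine (Asymptotics.isBigO_zero _ _).congr_left fun z => ?_
  simp [jetPoly]

lemma HasJet.id : HasJet (fun z => z) 0 1 0 0 0 := by
  refine (Asymptotics.isBigO_zero _ _).congr_left fun z => ?_
  simp [jetPoly]

lemma HasJet.const_mul {f : ℂ → ℂ} {a₀ a₁ a₂ a₃ a₄ : ℂ} (c : ℂ) (hf : HasJet f a₀ a₁ a₂ a₃ a₄) :
    HasJet (fun z => c * f z) (c * a₀) (c * a₁) (c * a₂) (c * a₃) (c * a₄) := by
  simpa using (HasJet.const c).mul hf

/-- One step of peeling off coefficients: letting `z → 0` kills `a`, then a factor `z` is cancelled.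
The punctured neighbourhood makes the division legitimate. -/
lemma eq_zero_of_add_mul_isBigO {a : ℂ} {g : ℂ → ℂ} {n : ℕ} (hg : Continuous g)
    (h : (fun z => a + z * g z) =O[𝓝[≠] 0] fun z : ℂ => z ^ (n + 1)) :
    a = 0 ∧ g =O[𝓝[≠] 0] fun z : ℂ => z ^ n := by
  have h1 : Tendsto (fun z => a + z * g z) (𝓝[≠] 0) (𝓝 a) := by
    have : Continuous fun z => a + z * g z := by fun_prop
    simpa using (this.tendsto 0).mono_left nhdsWithin_le_nhds
  have h2 : Tendsto (fun z : ℂ => z ^ (n + 1)) (𝓝[≠] 0) (𝓝 0) := by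
    simpa using ((continuous_pow (n + 1)).tendsto (0 : ℂ)).mono_left nhdsWithin_le_nhds
  have ha : a = 0 := tendsto_nhds_unique h1 (h.trans_tendsto h2)
  subst ha
  refine ⟨rfl, ?_⟩
  have h3 := (Asymptotics.isBigO_refl (fun z : ℂ => z⁻¹) (𝓝[≠] 0)).mul h
  refine h3.congr' ?_ ?_
  · filter_upwards [self_mem_nhdsWithin] with z (hz : z ≠ 0)
    field_simp; ring
  · filter_upwards [self_mem_nhdsWithin] with z (hz : z ≠ 0)
    field_simp
    ring

lemma HasJet.unique {f : ℂ → ℂ} {a₀ a₁ a₂ a₃ a₄ b₀ b₁ b₂ b₃ b₄ : ℂ}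
    (hf : HasJet f a₀ a₁ a₂ a₃ a₄) (hg : HasJet f b₀ b₁ b₂ b₃ b₄) :
    a₀ = b₀ ∧ a₁ = b₁ ∧ a₂ = b₂ ∧ a₃ = b₃ ∧ a₄ = b₄ := by
  have h := (Asymptotics.IsBigO.sub hg hf).mono (nhdsWithin_le_nhds (s := {0}ᶜ))
  have h : (fun z => (a₀ - b₀) + z * ((a₁ - b₁) + z * ((a₂ - b₂) + z * ((a₃ - b₃)
      + z * ((fun _ => a₄ - b₄) z))))) =O[𝓝[≠] 0] fun z : ℂ => z ^ (4 + 1) := by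
    refine h.congr_left fun z => ?_
    simp only [jetPoly]; ring
  obtain ⟨h0, h⟩ := eq_zero_of_add_mul_isBigO (by fun_prop) h
  obtain ⟨h1, h⟩ := eq_zero_of_add_mul_isBigO (n := 3) (by fun_prop) h
  obtain ⟨h2, h⟩ := eq_zero_of_add_mul_isBigO (n := 2) (by fun_prop) h
  obtain ⟨h3, h⟩ := eq_zero_of_add_mul_isBigO (n := 1) (by fun_prop) h
  have h : (fun z => (a₄ - b₄) + z * (fun _ => (0 : ℂ)) z) =O[𝓝[≠] 0] fun z : ℂ => z ^ (0 + 1) := by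
    simpa using h
  obtain ⟨h4, -⟩ := eq_zero_of_add_mul_isBigO (by fun_prop) h
  exact ⟨sub_eq_zero.1 h0, sub_eq_zero.1 h1, sub_eq_zero.1 h2, sub_eq_zero.1 h3, sub_eq_zero.1 h4⟩

lemma hasJet_of_analyticAt {f : ℂ → ℂ} (hf : AnalyticAt ℂ f 0) :
    HasJet f (coeff f 0) (coeff f 1) (coeff f 2) (coeff f 3) (coeff f 4) := by
  have h := hf.hasFPowerSeriesAt.isBigO_sub_partialSum_pow 5
  have h : (fun y => f (0 + y) - (FormalMultilinearSeries.ofScalars ℂ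
      (fun n ↦ iteratedDeriv n f 0 / n.factorial)).partialSum 5 y) =O[𝓝 0] fun y : ℂ => y ^ 5 := by
    simpa only [← norm_pow, Asymptotics.isBigO_norm_right] using h
  refine h.congr_left fun z => ?_
  simp [FormalMultilinearSeries.partialSum, Finset.sum_range_succ, jetPoly, coeff]
  ring

lemma coeff_deriv (f : ℂ → ℂ) (n : ℕ) : coeff (deriv f) n = (n + 1) * coeff f (n + 1) := by
  have : ((n.factorial : ℕ) : ℂ) ≠ 0 := by exact_mod_cast n.factorial_ne_zero
  have h2 : (n + 1 : ℂ) ≠ 0 := by exact_mod_cast n.succ_ne_zero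
  simp only [coeff, iteratedDeriv_succ', Nat.factorial_succ]
  push_cast
  field_simp

lemma hasJet_deriv {f : ℂ → ℂ} (hf : AnalyticAt ℂ f 0) :
    HasJet (deriv f) (coeff f 1) (2 * coeff f 2) (3 * coeff f 3) (4 * coeff f 4)
      (5 * coeff f 5) := by
  have := hasJet_of_analyticAt hf.deriv
  simp only [coeff_deriv] at this
  norm_num at this
  exact this

lemma U_mem_nhds : U ∈ 𝓝 (0 : ℂ) := Metric.ball_mem_nhds _ one_pos

lemma analyticAt_zero {f : ℂ → ℂ} (hf : DifferentiableOn ℂ f U) : AnalyticAt ℂ f 0 :=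
  hf.analyticAt U_mem_nhds

lemma coeff_zero (f : ℂ → ℂ) : coeff f 0 = f 0 := by simp [coeff]

lemma coeff_one (f : ℂ → ℂ) : coeff f 1 = deriv f 0 := by simp [coeff]

/-! ### Schwarz–Pick and the coefficients of Schwarz functions -/

lemma norm_sub_le_norm_one_sub_conj_mul {a w : ℂ} (ha : ‖a‖ ≤ 1) (hw : ‖w‖ ≤ 1) :
    ‖w - a‖ ≤ ‖1 - conj a * w‖ := by
  have key : ‖1 - conj a * w‖ ^ 2 - ‖w - a‖ ^ 2 = (1 - ‖a‖ ^ 2) * (1 - ‖w‖ ^ 2) := by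
    simp only [← Complex.normSq_eq_norm_sq, Complex.normSq_apply]
    simp
    ring
  have h1 : 0 ≤ 1 - ‖a‖ ^ 2 := by nlinarith [norm_nonneg a]
  have h2 : 0 ≤ 1 - ‖w‖ ^ 2 := by nlinarith [norm_nonneg w]
  exact (pow_le_pow_iff_left₀ (norm_nonneg _) (norm_nonneg _) two_ne_zero).1
    (by nlinarith [mul_nonneg h1 h2])

/-- The Möbius transform of `g` sending `g 0` to the origin. -/
noncomputable def mobius (g : ℂ → ℂ) (z : ℂ) : ℂ := (g z - g 0) / (1 - conj (g 0) * g z)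

lemma one_sub_conj_mul_ne_zero {a w : ℂ} (ha : ‖a‖ < 1) (hw : ‖w‖ ≤ 1) :
    1 - conj a * w ≠ 0 := by
  intro h
  have : ‖conj a * w‖ = 1 := by rw [← sub_eq_zero.1 h, norm_one]
  rw [norm_mul, RCLike.norm_conj] at this
  nlinarith [norm_nonneg a, norm_nonneg w]

lemma differentiableOn_mobius {g : ℂ → ℂ} (hg : DifferentiableOn ℂ g U) (h0 : ‖g 0‖ < 1)
    (hb : ∀ z ∈ U, ‖g z‖ ≤ 1) : DifferentiableOn ℂ (mobius g) U :=
  (hg.sub_const _).div ((hg.const_mul _).const_sub 1)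
    fun z hz => one_sub_conj_mul_ne_zero h0 (hb z hz)

lemma norm_mobius_le {g : ℂ → ℂ} (h0 : ‖g 0‖ < 1) (hb : ∀ z ∈ U, ‖g z‖ ≤ 1) :
    ∀ z ∈ U, ‖mobius g z‖ ≤ 1 := fun z hz => by
  rw [mobius, norm_div]
  exact div_le_one_of_le₀ (norm_sub_le_norm_one_sub_conj_mul h0.le (hb z hz)) (norm_nonneg _)

lemma norm_dslope_le_one {g : ℂ → ℂ} (hg : DifferentiableOn ℂ g U) (h0 : g 0 = 0)
    (hb : ∀ z ∈ U, ‖g z‖ ≤ 1) : ∀ z ∈ U, ‖dslope g 0 z‖ ≤ 1 := fun z hz => by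
  have := Complex.norm_dslope_le_div_of_mapsTo_ball (R₂ := 1) hg
    (fun w hw => by simpa [h0] using hb w hw) hz
  simpa using this

lemma zero_mem_U : (0 : ℂ) ∈ U := by simp [U]

/-- Division of `mobius g z * (1 - conj (g 0) * g z) = g z - g 0` by `z`. At the origin it yields
Schwarz–Pick; its first-order jet yields the third Schwarz coefficient. -/
lemma dslope_mobius_mul {g : ℂ → ℂ} (h0 : ‖g 0‖ < 1) (hd : DifferentiableAt ℂ g 0)
    (hb : ∀ z ∈ U, ‖g z‖ ≤ 1) {z : ℂ} (hz : z ∈ U) :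
    dslope (mobius g) 0 z * (1 - conj (g 0) * g z) = dslope g 0 z := by
  have hne := one_sub_conj_mul_ne_zero h0 (hb z hz)
  rcases eq_or_ne z 0 with rfl | hz0
  · have h1 : HasDerivAt (mobius g) _ 0 :=
      (hd.hasDerivAt.sub_const (g 0)).div ((hd.hasDerivAt.const_mul (conj (g 0))).const_sub 1) hne
    rw [dslope_same, dslope_same, h1.deriv]
    field_simp
    ring
  · rw [dslope_of_ne _ hz0, dslope_of_ne _ hz0, slope_def_field, slope_def_field]
    simp only [mobius, sub_self, zero_div, sub_zero]
    rw [div_div, mul_comm _ z, ← div_div, div_mul_cancel₀ _ hne]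

/-- Schwarz–Pick at the origin. -/
lemma norm_deriv_le_one_sub_sq {g : ℂ → ℂ} (hg : DifferentiableOn ℂ g U)
    (hb : ∀ z ∈ U, ‖g z‖ ≤ 1) : ‖deriv g 0‖ ≤ 1 - ‖g 0‖ ^ 2 := by
  have main : ∀ f : ℂ → ℂ, DifferentiableOn ℂ f U → (∀ z ∈ U, ‖f z‖ ≤ 1) → ‖f 0‖ < 1 →
      ‖deriv f 0‖ ≤ 1 - ‖f 0‖ ^ 2 := by
    intro f hf hfb hf0
    have h := dslope_mobius_mul hf0 (hf.differentiableAt U_mem_nhds) hfb zero_mem_U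
    have h1 := norm_dslope_le_one (differentiableOn_mobius hf hf0 hfb) (by simp [mobius])
      (norm_mobius_le hf0 hfb) 0 zero_mem_U
    rw [dslope_same f, Complex.conj_mul'] at h
    rw [← h, norm_mul]
    have h2 : ‖(1 : ℂ) - (‖f 0‖ : ℂ) ^ 2‖ = 1 - ‖f 0‖ ^ 2 := by
      have : ((1 - ‖f 0‖ ^ 2 : ℝ) : ℂ) = (1 : ℂ) - (‖f 0‖ : ℂ) ^ 2 := by push_cast; ring
      rw [← this, Complex.norm_real, Real.norm_of_nonneg]
      nlinarith [norm_nonneg (f 0)]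
    rw [h2]
    have : 0 ≤ 1 - ‖f 0‖ ^ 2 := by nlinarith [norm_nonneg (f 0)]
    nlinarith
  -- The Möbius map degenerates when `‖g 0‖ = 1`, so the strict case is applied to `r g` and `r`
  -- tends to `1` from below.
  have hev : ∀ᶠ r : ℝ in 𝓝[<] 1, r * ‖deriv g 0‖ ≤ 1 - (r * ‖g 0‖) ^ 2 := by
    filter_upwards [Ioo_mem_nhdsLT (show (0 : ℝ) < 1 by norm_num)] with r ⟨hr0, hr1⟩
    have hn : ‖(r : ℂ)‖ = r := by simp [hr0.le]
    have hlt : ∀ z ∈ U, ‖(r : ℂ) * g z‖ < 1 := fun z hz => by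
      rw [norm_mul, hn]
      nlinarith [hb z hz, norm_nonneg (g z)]
    have h := main (fun z => (r : ℂ) * g z) (hg.const_mul _) (fun z hz => (hlt z hz).le)
      (hlt 0 zero_mem_U)
    rwa [deriv_const_mul _ (hg.differentiableAt U_mem_nhds), norm_mul, norm_mul, hn] at h
  have t1 : Tendsto (fun r : ℝ => r * ‖deriv g 0‖) (𝓝[<] 1) (𝓝 ‖deriv g 0‖) := by
    have : Continuous fun r : ℝ => r * ‖deriv g 0‖ := by fun_prop
    simpa using (this.tendsto 1).mono_left nhdsWithin_le_nhds
  have t2 : Tendsto (fun r : ℝ => 1 - (r * ‖g 0‖) ^ 2) (𝓝[<] 1) (𝓝 (1 - ‖g 0‖ ^ 2)) := by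
    have : Continuous fun r : ℝ => 1 - (r * ‖g 0‖) ^ 2 := by fun_prop
    simpa using (this.tendsto 1).mono_left nhdsWithin_le_nhds
  exact le_of_tendsto_of_tendsto t1 t2 hev

lemma coeff_dslope {g : ℂ → ℂ} (hg : DifferentiableOn ℂ g U) :
    coeff (dslope g 0) 0 = coeff g 1 ∧ coeff (dslope g 0) 1 = coeff g 2 ∧
      coeff (dslope g 0) 2 = coeff g 3 := by
  have hd : DifferentiableOn ℂ (dslope g 0) U :=
    (Complex.differentiableOn_dslope U_mem_nhds).2 hg
  have h1 := (HasJet.id.mul (hasJet_of_analyticAt (analyticAt_zero hd))).add (HasJet.const (g 0))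
  have h2 := h1.congr (g := g) (Eventually.of_forall fun z => by
    have := sub_smul_dslope g 0 z
    simp only [sub_zero, smul_eq_mul] at this
    simp only [this]; ring)
  have := h2.unique (hasJet_of_analyticAt (analyticAt_zero hg))
  simp at this
  tauto

/-- Parametrization of the first three coefficients of a Schwarz function. -/
lemma schwarz_coeff {w : ℂ → ℂ} (hw : DifferentiableOn ℂ w U) (h0 : w 0 = 0) (hm : MapsTo w U U) :
    ‖coeff w 1‖ ≤ 1 ∧ ‖coeff w 2‖ ≤ 1 - ‖coeff w 1‖ ^ 2 ∧
    (‖coeff w 1‖ < 1 → ∃ x s : ℂ, ‖x‖ ≤ 1 ∧ ‖s‖ ≤ 1 - ‖x‖ ^ 2 ∧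
      coeff w 2 = (1 - ‖coeff w 1‖ ^ 2) * x ∧
      coeff w 3 = (1 - ‖coeff w 1‖ ^ 2) * (s - conj (coeff w 1) * x ^ 2)) := by
  set g := dslope w 0 with hg
  have hgd : DifferentiableOn ℂ g U := (Complex.differentiableOn_dslope U_mem_nhds).2 hw
  have hgb : ∀ z ∈ U, ‖g z‖ ≤ 1 := norm_dslope_le_one hw h0 fun z hz => by
    have := hm hz
    simp only [U, Metric.mem_ball, dist_zero_right] at this
    exact this.le
  obtain ⟨e1, e2, e3⟩ := coeff_dslope hw
  rw [← hg] at e1 e2 e3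
  have hg0 : g 0 = coeff w 1 := by rw [← e1, coeff_zero]
  refine ⟨?_, ?_, ?_⟩
  · rw [← hg0]; exact hgb 0 zero_mem_U
  · rw [← e2, coeff_one, ← hg0]; exact norm_deriv_le_one_sub_sq hgd hgb
  · intro hlt
    have hlt' : ‖g 0‖ < 1 := by rwa [hg0]
    -- Schur step: `m` is again bounded by one, and the parameters are `x = m 0`, `s = m' 0`, with
    -- Schwarz–Pick for `m` bounding `s`.
    set m := dslope (mobius g) 0 with hmdef
    have hmd : DifferentiableOn ℂ m U :=
      (Complex.differentiableOn_dslope U_mem_nhds).2 (differentiableOn_mobius hgd hlt' hgb)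
    have hmb : ∀ z ∈ U, ‖m z‖ ≤ 1 :=
      norm_dslope_le_one (differentiableOn_mobius hgd hlt' hgb) (by simp [mobius])
        (norm_mobius_le hlt' hgb)
    have hjet := (hasJet_of_analyticAt (analyticAt_zero hmd)).mul ((HasJet.const 1).add
      ((hasJet_of_analyticAt (analyticAt_zero hgd)).const_mul (-conj (g 0))))
    have hjet2 := hjet.congr (g := dslope g 0) (by
      filter_upwards [U_mem_nhds] with z hz
      rw [← dslope_mobius_mul hlt' (hgd.differentiableAt U_mem_nhds) hgb hz]
      ring)
    have hgd2 : DifferentiableOn ℂ (dslope g 0) U :=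
      (Complex.differentiableOn_dslope U_mem_nhds).2 hgd
    obtain ⟨f1, f2, -⟩ := coeff_dslope hgd
    obtain ⟨r1, r2, -⟩ := hjet2.unique (hasJet_of_analyticAt (analyticAt_zero hgd2))
    rw [f1, e2] at r1
    rw [f2, e3] at r2
    rw [e1, hg0] at r1 r2
    rw [e2] at r2
    have hcc : conj (coeff w 1) * coeff w 1 = (‖coeff w 1‖ : ℂ) ^ 2 := Complex.conj_mul' _
    have hc2 : coeff w 2 = (1 - ‖coeff w 1‖ ^ 2) * coeff m 0 := by
      rw [← r1, ← hcc]; ring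
    refine ⟨coeff m 0, coeff m 1, ?_, ?_, hc2, ?_⟩
    · rw [coeff_zero]; exact hmb 0 zero_mem_U
    · rw [coeff_zero, coeff_one]; exact norm_deriv_le_one_sub_sq hmd hmb
    · rw [← r2, hc2, ← hcc]; ring

/-! ### Coefficients of the Hadamard product and of `fDelta` -/

lemma exists_norm_coeff_mul_pow_le {f : ℂ → ℂ} (hf : DifferentiableOn ℂ f U) :
    ∃ C : ℝ, ∀ n, ‖coeff f n‖ * (1 / 2) ^ n ≤ C := by
  have hz : (1 / 2 : ℂ) ∈ Metric.ball (0 : ℂ) 1 := by simp; norm_num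
  have h := (Complex.hasSum_taylorSeries_on_ball hf hz).summable.tendsto_atTop_zero.norm
  obtain ⟨C, hC⟩ := h.bddAbove_range
  refine ⟨C, fun n => ?_⟩
  have := hC (mem_range_self n)
  refine le_trans (le_of_eq ?_) this
  simp [coeff]
  ring

/-- Multiplying the coefficient bounds at radius `1/2` gives convergence of the product series at
least to radius `1/4`; uniqueness of power series then identifies its coefficients. -/
lemma coeff_hadamard {f g : ℂ → ℂ} (hf : DifferentiableOn ℂ f U) (hg : DifferentiableOn ℂ g U)
    (n : ℕ) : coeff (hadamard f g) n = coeff f n * coeff g n := by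
  set p := FormalMultilinearSeries.ofScalars ℂ (fun n => coeff f n * coeff g n) with hp
  obtain ⟨C, hC⟩ := exists_norm_coeff_mul_pow_le hf
  obtain ⟨D, hD⟩ := exists_norm_coeff_mul_pow_le hg
  have hr : ((1 / 4 : NNReal) : ENNReal) ≤ p.radius := by
    refine p.le_radius_of_bound (C * D) fun n => ?_
    rw [hp, FormalMultilinearSeries.ofScalars_norm, norm_mul]
    have h4 : (((1 / 4 : NNReal) : ℝ)) ^ n = (1 / 2) ^ n * (1 / 2) ^ n := by
      rw [← mul_pow]; norm_num
    rw [h4, mul_mul_mul_comm]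
    exact mul_le_mul (hC n) (hD n) (by positivity) (le_trans (by positivity) (hC n))
  have hpos : 0 < p.radius := lt_of_lt_of_le (by norm_num) hr
  have h1 := (p.hasFPowerSeriesOnBall hpos).hasFPowerSeriesAt
  have h2 : p.sum = hadamard f g := by
    ext z
    simp only [hadamard, FormalMultilinearSeries.sum, hp]
    refine tsum_congr fun n => ?_
    rw [FormalMultilinearSeries.ofScalars_apply_eq, smul_eq_mul]
  rw [h2] at h1
  have h3 := h1.eq_formalMultilinearSeries h1.analyticAt.hasFPowerSeriesAt
  have h4 := congrFun (FormalMultilinearSeries.ofScalars_series_injective ℂ ℂ h3) n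
  exact h4.symm

/-- Closed form of `fDelta`. -/
noncomputable def fDeltaClosed (δ : ℝ) (z : ℂ) : ℂ :=
  (((1 + z) / (1 - z)) ^ (δ : ℂ) - 1) / (2 * δ)

lemma one_sub_ne_zero_of_mem_U {z : ℂ} (hz : z ∈ U) : 1 - z ≠ 0 ∧ 1 + z ≠ 0 := by
  simp only [U, Metric.mem_ball, dist_zero_right] at hz
  constructor
  · intro h
    rw [← sub_eq_zero.1 h, norm_one] at hz
    exact lt_irrefl _ hz
  · intro h
    rw [← norm_neg, ← eq_neg_of_add_eq_zero_left h, norm_one] at hz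
    exact lt_irrefl _ hz

lemma cayley_mem_slitPlane {z : ℂ} (hz : z ∈ U) : (1 + z) / (1 - z) ∈ Complex.slitPlane := by
  obtain ⟨h1, -⟩ := one_sub_ne_zero_of_mem_U hz
  left
  have hn : 0 < Complex.normSq (1 - z) := Complex.normSq_pos.2 h1
  simp only [U, Metric.mem_ball, dist_zero_right] at hz
  have hz2 : Complex.normSq z < 1 := by
    rw [Complex.normSq_eq_norm_sq]; nlinarith [norm_nonneg z]
  rw [Complex.normSq_apply] at hz2
  rw [Complex.div_re, ← add_div]
  apply div_pos _ hn
  simp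
  nlinarith

lemma hasDerivAt_fDeltaClosed {δ : ℝ} (hδ : δ ≠ 0) {z : ℂ} (hz : z ∈ U) :
    HasDerivAt (fDeltaClosed δ) (((1 + z) / (1 - z)) ^ (δ : ℂ) * (1 / (1 - z ^ 2))) z := by
  obtain ⟨h1, h2⟩ := one_sub_ne_zero_of_mem_U hz
  have hB : HasDerivAt (fun z : ℂ => (1 + z) / (1 - z)) _ z :=
    ((hasDerivAt_id z).const_add 1).div ((hasDerivAt_id z).const_sub 1) h1
  have h := ((hB.cpow_const (c := (δ : ℂ)) (cayley_mem_slitPlane hz)).sub_const 1).div_const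
    (2 * (δ : ℂ))
  refine h.congr_deriv ?_
  have hδ' : (δ : ℂ) ≠ 0 := by exact_mod_cast hδ
  have h3 : 1 - z ^ 2 ≠ 0 := by
    rw [show 1 - z ^ 2 = (1 - z) * (1 + z) by ring]; exact mul_ne_zero h1 h2
  rw [Complex.cpow_sub _ _ (div_ne_zero h2 h1), Complex.cpow_one]
  simp only [id]
  generalize ((1 + z) / (1 - z)) ^ (δ : ℂ) = W
  field_simp
  ring

lemma smul_mem_U {z : ℂ} (hz : z ∈ U) {s : ℝ} (hs : s ∈ Icc (0 : ℝ) 1) : (s : ℂ) * z ∈ U := by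
  simp only [U, Metric.mem_ball, dist_zero_right, norm_mul, Complex.norm_real,
    Real.norm_of_nonneg hs.1] at hz ⊢
  nlinarith [norm_nonneg z, hs.1, hs.2]

lemma fDelta_eq {δ : ℝ} (hδ : δ ≠ 0) {z : ℂ} (hz : z ∈ U) : fDelta δ z = fDeltaClosed δ z := by
  have hd : ∀ s ∈ uIcc (0 : ℝ) 1, HasDerivAt (fun s : ℝ => fDeltaClosed δ ((s : ℂ) * z))
      (z * (((1 + (s : ℂ) * z) / (1 - (s : ℂ) * z)) ^ (δ : ℂ) *
        (1 / (1 - ((s : ℂ) * z) ^ 2)))) s := by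
    intro s hs
    rw [uIcc_of_le zero_le_one] at hs
    have h1 : HasDerivAt (fun s : ℝ => (s : ℂ) * z) z s := by
      simpa using (Complex.ofRealCLM.hasDerivAt (x := s)).mul_const z
    have := (hasDerivAt_fDeltaClosed hδ (smul_mem_U hz hs)).comp s h1
    exact this.congr_deriv (mul_comm _ _)
  have hc : ContinuousOn (fun s : ℝ => z * (((1 + (s : ℂ) * z) / (1 - (s : ℂ) * z)) ^ (δ : ℂ) *
        (1 / (1 - ((s : ℂ) * z) ^ 2)))) (uIcc 0 1) := by
    rw [uIcc_of_le zero_le_one]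
    have h1 : ContinuousOn (fun s : ℝ => (1 + (s : ℂ) * z) / (1 - (s : ℂ) * z)) (Icc 0 1) :=
      ContinuousOn.div (by fun_prop) (by fun_prop)
        fun s hs => (one_sub_ne_zero_of_mem_U (smul_mem_U hz hs)).1
    refine continuousOn_const.mul (ContinuousOn.mul ?_ ?_)
    · exact h1.cpow_const fun s hs => cayley_mem_slitPlane (smul_mem_U hz hs)
    · refine ContinuousOn.div (by fun_prop) (by fun_prop) fun s hs => ?_
      obtain ⟨h1, h2⟩ := one_sub_ne_zero_of_mem_U (smul_mem_U hz hs)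
      rw [show 1 - ((s : ℂ) * z) ^ 2 = (1 - s * z) * (1 + s * z) by ring]
      exact mul_ne_zero h1 h2
  have h := intervalIntegral.integral_eq_sub_of_hasDerivAt hd hc.intervalIntegrable
  rw [intervalIntegral.integral_const_mul] at h
  rw [fDelta, h]
  simp [fDeltaClosed]

lemma differentiableOn_fDeltaClosed {δ : ℝ} (hδ : δ ≠ 0) :
    DifferentiableOn ℂ (fDeltaClosed δ) U := fun _ hz =>
  (hasDerivAt_fDeltaClosed hδ hz).differentiableAt.differentiableWithinAt

lemma differentiableOn_fDelta {δ : ℝ} (hδ : δ ≠ 0) : DifferentiableOn ℂ (fDelta δ) U :=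
  (differentiableOn_fDeltaClosed hδ).congr fun _ hz => fDelta_eq hδ hz

/-- The closed form satisfies `(1 - z²) F' = 1 + 2 δ F`, which determines the coefficients
recursively. -/
lemma coeff_fDelta {δ : ℝ} (hδ : δ ≠ 0) :
    coeff (fDelta δ) 2 = δ ∧ coeff (fDelta δ) 3 = (2 * δ ^ 2 + 1) / 3 ∧
      coeff (fDelta δ) 4 = (δ ^ 3 + 2 * δ) / 3 := by
  have hδ' : (δ : ℂ) ≠ 0 := by exact_mod_cast hδ
  have hA := analyticAt_zero (differentiableOn_fDelta hδ)
  have hl := ((HasJet.const 1).add ((HasJet.id.mul HasJet.id).const_mul (-1))).mul (hasJet_deriv hA)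
  have hr := (HasJet.const 1).add ((hasJet_of_analyticAt hA).const_mul (2 * δ))
  have heq : (fun z : ℂ => (1 + (-1) * (z * z)) * deriv (fDelta δ) z) =ᶠ[𝓝 0]
      fun z => 1 + 2 * δ * fDelta δ z := by
    have hU : ∀ᶠ z in 𝓝 (0 : ℂ), z ∈ U := U_mem_nhds
    have hev : fDelta δ =ᶠ[𝓝 0] fDeltaClosed δ := hU.mono fun z hz => fDelta_eq hδ hz
    filter_upwards [hU, hev.eventuallyEq_nhds] with z hz hzz
    obtain ⟨h1, h2⟩ := one_sub_ne_zero_of_mem_U hz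
    have h3 : 1 - z ^ 2 ≠ 0 := by
      rw [show 1 - z ^ 2 = (1 - z) * (1 + z) by ring]; exact mul_ne_zero h1 h2
    rw [hzz.deriv_eq, hzz.eq_of_nhds, (hasDerivAt_fDeltaClosed hδ hz).deriv, fDeltaClosed]
    field_simp
    ring
  have h0 : coeff (fDelta δ) 0 = 0 := by simp [coeff_zero, fDelta]
  obtain ⟨e0, e1, e2, e3, -⟩ := (hl.congr heq).unique hr
  rw [h0] at e0
  simp at e0 e1 e2 e3
  rw [e0] at e1 e2
  have b2 : coeff (fDelta δ) 2 = δ := by linear_combination e1 / 2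
  rw [b2] at e2 e3
  have b3 : coeff (fDelta δ) 3 = (2 * δ ^ 2 + 1) / 3 := by linear_combination e2 / 3
  rw [b3] at e3
  exact ⟨b2, b3, by linear_combination e3 / 4⟩

/-! ### Coefficient relations from subordination and inversion -/

/-- The functional equation behind `z h'/h ≺ 1/(1 - 2tz + z²)`, coefficientwise. -/
lemma coeff_of_subordinate {t : ℝ} {h : ℂ → ℂ} (hd : DifferentiableOn ℂ h U) (h0 : h 0 = 0)
    (h1 : deriv h 0 = 1) (hs : Subordinate (starlikeQuotient h) (chebyshevGen t)) :
    ∃ w : ℂ → ℂ, DifferentiableOn ℂ w U ∧ w 0 = 0 ∧ MapsTo w U U ∧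
      coeff h 2 = 2 * t * coeff w 1 ∧
      2 * coeff h 3 = 4 * t * coeff w 1 * coeff h 2 + 2 * t * coeff w 2 - coeff w 1 ^ 2 ∧
      3 * coeff h 4 = 6 * t * coeff w 1 * coeff h 3
        + 2 * coeff h 2 * (2 * t * coeff w 2 - coeff w 1 ^ 2)
        + 2 * t * coeff w 3 - 2 * coeff w 1 * coeff w 2 := by
  obtain ⟨w, hwd, hw0, hwm, hw⟩ := hs
  refine ⟨w, hwd, hw0, hwm, ?_⟩
  have hA := analyticAt_zero hd
  have hW := hasJet_of_analyticAt (analyticAt_zero hwd)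
  have hl := (HasJet.id.mul (hasJet_deriv hA)).mul
    (((HasJet.const 1).add (hW.const_mul (-2 * t))).add (hW.mul hW))
  have hsl : ContinuousAt (dslope h 0) 0 :=
    continuousAt_dslope_same.2 (hd.differentiableAt U_mem_nhds)
  have hne : ∀ᶠ z in 𝓝 (0 : ℂ), dslope h 0 z ≠ 0 :=
    hsl.eventually_ne (by rw [dslope_same, h1]; exact one_ne_zero)
  have hwc : ContinuousAt w 0 := (hwd.differentiableAt U_mem_nhds).continuousAt
  have hne2 : ∀ᶠ z in 𝓝 (0 : ℂ), 1 - 2 * (t : ℂ) * w z + w z ^ 2 ≠ 0 := by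
    have : ContinuousAt (fun z => 1 - 2 * (t : ℂ) * w z + w z ^ 2) 0 := by fun_prop
    exact this.eventually_ne (by simp [hw0])
  have heq : (fun z => z * deriv h z * (1 + (-2 * (t : ℂ)) * w z + w z * w z)) =ᶠ[𝓝 0] h := by
    filter_upwards [hne, hne2, U_mem_nhds] with z hz1 hz2 hzU
    have e := hw z hzU
    rw [starlikeQuotient, chebyshevGen, div_eq_div_iff hz1 hz2] at e
    have e2 := sub_smul_dslope h 0 z
    simp only [sub_zero, smul_eq_mul, h0] at e2
    linear_combination z * e + e2
  obtain ⟨-, -, e2, e3, e4⟩ := (hl.congr heq).unique (hasJet_of_analyticAt hA)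
  rw [coeff_zero w, hw0, coeff_one h, h1] at e2 e3 e4
  refine ⟨?_, ?_, ?_⟩
  · linear_combination e2
  · linear_combination e3
  · linear_combination e4

lemma HasJet.of_sub {f g : ℂ → ℂ} {a₀ a₁ a₂ a₃ a₄ : ℂ} (hg : HasJet g a₀ a₁ a₂ a₃ a₄)
    (h : (fun z => f z - g z) =O[𝓝 0] fun z : ℂ => z ^ 5) : HasJet f a₀ a₁ a₂ a₃ a₄ :=
  (h.add hg).congr_left fun z => by ring

/-- Coefficients of the inverse of a normalized function. -/
lemma coeff_inverse {h k : ℂ → ℂ} (hb : IsBiUnivalent h k) :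
    deriv k 0 = 1 ∧ coeff k 2 = -coeff h 2 ∧ coeff k 3 = 2 * coeff h 2 ^ 2 - coeff h 3 ∧
      coeff k 4 = -(5 * coeff h 2 ^ 3 - 5 * coeff h 2 * coeff h 3 + coeff h 4) := by
  have hk := hasJet_of_analyticAt (analyticAt_zero hb.inv_diff)
  have hh := hasJet_of_analyticAt (analyticAt_zero hb.normalized.diff)
  have hk0 : coeff k 0 = 0 := by rw [coeff_zero, hb.inv_zero]
  have hkO : k =O[𝓝 0] fun z : ℂ => z := by
    have := (hb.inv_diff.differentiableAt U_mem_nhds).isBigO_sub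
    simpa [hb.inv_zero] using this
  have hkt : Tendsto k (𝓝 0) (𝓝 0) := by
    have := (hb.inv_diff.differentiableAt U_mem_nhds).continuousAt.tendsto
    rwa [hb.inv_zero] at this
  -- Since `k z = O(z)`, the remainder of `h` at `k z` is still `O(z⁵)`, so only powers of the jet
  -- of `k` are needed.
  have hcomp : (fun z => h (k z) - jetPoly (coeff h 0) (coeff h 1) (coeff h 2) (coeff h 3)
      (coeff h 4) (k z)) =O[𝓝 0] fun z : ℂ => z ^ 5 :=
    (Asymptotics.IsBigO.comp_tendsto hh hkt).trans (hkO.pow 5)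
  have hp2 := hk.mul hk
  have hp3 := hp2.mul hk
  have hp4 := hp3.mul hk
  have hpoly := ((hk.add (hp2.const_mul (coeff h 2))).add (hp3.const_mul (coeff h 3))).add
    (hp4.const_mul (coeff h 4))
  have h0 : coeff h 0 = 0 := by rw [coeff_zero, hb.normalized.map_zero]
  have h1 : coeff h 1 = 1 := by rw [coeff_one, hb.normalized.deriv_zero]
  have hid := hpoly.of_sub (f := fun z => h (k z)) (hcomp.congr_left fun z => by
    simp only [jetPoly, h0, h1]; ring)
  obtain ⟨-, e1, e2, e3, e4⟩ := (hid.congr hb.right_inv).unique HasJet.id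
  rw [hk0] at e1 e2 e3 e4
  have k1 : coeff k 1 = 1 := by linear_combination e1
  rw [k1] at e2 e3 e4
  have k2 : coeff k 2 = -coeff h 2 := by linear_combination e2
  rw [k2] at e3 e4
  have k3 : coeff k 3 = 2 * coeff h 2 ^ 2 - coeff h 3 := by linear_combination e3
  rw [k3] at e4
  refine ⟨by rw [← coeff_one, k1], k2, k3, by linear_combination e4⟩

/-- Parametrization of the coefficients of a bi-starlike function. -/
lemma exists_parameters {t : ℝ} {h : ℂ → ℂ} (ht : t ≠ 0) (hb : BiStarlike t h) :
    ∃ c x y s s' : ℂ, ∃ q : ℝ, q = 1 - ‖c‖ ^ 2 ∧ ‖c‖ ≤ 1 ∧ ‖x‖ ≤ 1 ∧ ‖y‖ ≤ 1 ∧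
      ‖s‖ ≤ 1 - ‖x‖ ^ 2 ∧ ‖s'‖ ≤ 1 - ‖y‖ ^ 2 ∧
      coeff h 2 = 2 * t * c ∧
      coeff h 3 = 4 * t ^ 2 * c ^ 2 + t / 2 * (q * (x - y)) ∧
      6 * coeff h 4 = 15 * coeff h 2 * coeff h 3 - 11 * coeff h 2 ^ 3
        + 2 * t * (q * (s - s' - conj c * (x ^ 2 + y ^ 2)))
        + 2 * (4 * t ^ 2 - 1) * c * (q * (x + y)) + 2 * (8 * t ^ 3 - 4 * t) * c ^ 3 := by
  obtain ⟨k, hk, hs1, hs2⟩ := hb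
  obtain ⟨k1, k2, k3, k4⟩ := coeff_inverse hk
  obtain ⟨w, hwd, hw0, hwm, a2, a3, a4⟩ := coeff_of_subordinate hk.normalized.diff
    hk.normalized.map_zero hk.normalized.deriv_zero hs1
  obtain ⟨v, hvd, hv0, hvm, b2, b3, b4⟩ := coeff_of_subordinate hk.inv_diff hk.inv_zero k1 hs2
  obtain ⟨w1, w2, w3⟩ := schwarz_coeff hwd hw0 hwm
  obtain ⟨v1, v2, v3⟩ := schwarz_coeff hvd hv0 hvm
  have ht' : (t : ℂ) ≠ 0 := by exact_mod_cast ht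
  have hv : coeff v 1 = -coeff w 1 := by
    have : 2 * (t : ℂ) * (coeff v 1 + coeff w 1) = 0 := by linear_combination -b2 - a2 + k2
    have := (mul_eq_zero.1 this).resolve_left (mul_ne_zero two_ne_zero ht')
    linear_combination this
  rw [hv, norm_neg] at v1 v2 v3
  rw [k2, k3, hv] at b3
  rw [k2, k3, k4, hv] at b4
  rw [a2] at a3 a4 b3 b4
  -- If `|c| = 1` then `w₂ = v₂ = 0`; the sum of the two third-coefficient relations, `t (w₂ + v₂) =
  -- c²`, would then force `c = 0`.
  have hlt : ‖coeff w 1‖ < 1 := by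
    by_contra hge
    have h1 : ‖coeff w 1‖ = 1 := le_antisymm w1 (not_lt.1 hge)
    rw [h1] at w2 v2
    have w20 : coeff w 2 = 0 := norm_le_zero_iff.1 (by simpa using w2)
    have v20 : coeff v 2 = 0 := norm_le_zero_iff.1 (by simpa using v2)
    have : coeff w 1 ^ 2 = 0 := by
      rw [w20] at a3; rw [v20] at b3
      linear_combination (a3 + b3) / 2
    rw [pow_eq_zero_iff two_ne_zero] at this
    rw [this] at h1
    simp at h1
  obtain ⟨x, s, hx, hs, w2', w3'⟩ := w3 hlt
  obtain ⟨y, s', hy, hs', v2', v3'⟩ := v3 hlt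
  rw [w2'] at a3 a4
  rw [w3'] at a4
  rw [v2'] at b3 b4
  rw [v3'] at b4
  rw [map_neg] at b4
  set c := coeff w 1
  refine ⟨c, x, y, s, s', 1 - ‖c‖ ^ 2, rfl, w1, hx, hy, hs, hs', a2, ?_, ?_⟩
  · push_cast
    linear_combination (a3 - b3) / 4
  · push_cast
    rw [a2]
    linear_combination a4 - b4

/-! ### Sign and monotonicity of `gap` -/

/-- `-χ₁(1, 0, δ; t) / (72 t)` in terms of `x = δ²`. -/
noncomputable def gap (x t : ℝ) : ℝ :=
  -4 * (2 * x + 1) ^ 2 + t * (7 * x ^ 2 - 2 * x + 4) + 2 * t ^ 2 * (56 * x ^ 2 + 20 * x + 23)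
    - 8 * t * |6 * t ^ 2 * (x - 1) ^ 2 - (2 * x + 1) ^ 2|

lemma chi1_eq (δ : ℝ) {t : ℝ} (ht : 0 < t) : chi1 1 0 δ t = -72 * t * gap (δ ^ 2) t := by
  have u1 : chebU 1 t = 2 * t := by simp [chebU]
  have u2 : chebU 2 t = 4 * t ^ 2 - 1 := by
    simp only [chebU]; norm_num [Polynomial.Chebyshev.U_two]
  have u3 : chebU 3 t = 8 * t ^ 3 - 4 * t := by
    have := Polynomial.Chebyshev.U_add_two ℝ 1
    norm_num at this
    simp only [chebU]
    norm_num [this, Polynomial.Chebyshev.U_two]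
    ring
  have hO : Omega 1 0 δ t
      = 72 * (t * (6 * t ^ 2 * (δ ^ 2 - 1) ^ 2 - (2 * δ ^ 2 + 1) ^ 2)) := by
    simp only [Omega, u1, u3]; ring
  have habs : |Omega 1 0 δ t|
      = 72 * (t * |6 * t ^ 2 * (δ ^ 2 - 1) ^ 2 - (2 * δ ^ 2 + 1) ^ 2|) := by
    rw [hO, abs_mul, abs_mul, abs_of_pos ht, abs_of_pos (by norm_num : (0 : ℝ) < 72)]
  simp only [chi1, habs, gap, u1, u2]
  ring

lemma continuous_gap (x : ℝ) : Continuous (gap x) := by unfold gap; fun_prop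

/-- The increment of the absolute-value term over `[s, t]` is dominated by that of the polynomial
terms, after factoring out `t - s`. -/
lemma gap_lt_gap {x s t : ℝ} (hx : 1 ≤ x) (hs : 1 / 2 ≤ s) (hst : s < t) (ht : t ≤ 1) :
    gap x s < gap x t := by
  have hs0 : 0 < s := by linarith
  have ht0 : 0 < t := by linarith
  have e1 : ∀ r : ℝ, 0 < r → r * |6 * r ^ 2 * (x - 1) ^ 2 - (2 * x + 1) ^ 2|
      = |6 * r ^ 3 * (x - 1) ^ 2 - r * (2 * x + 1) ^ 2| := fun r hr => by
    rw [← abs_of_pos hr, ← abs_mul, abs_of_pos hr]; ring_nf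
  have h1 := abs_sub_abs_le_abs_sub (6 * t ^ 3 * (x - 1) ^ 2 - t * (2 * x + 1) ^ 2)
    (6 * s ^ 3 * (x - 1) ^ 2 - s * (2 * x + 1) ^ 2)
  rw [← e1 t ht0, ← e1 s hs0] at h1
  have h2 : 6 * t ^ 3 * (x - 1) ^ 2 - t * (2 * x + 1) ^ 2
      - (6 * s ^ 3 * (x - 1) ^ 2 - s * (2 * x + 1) ^ 2)
      = (t - s) * (6 * (t ^ 2 + s * t + s ^ 2) * (x - 1) ^ 2 - (2 * x + 1) ^ 2) := by ring
  rw [h2, abs_mul, abs_of_pos (sub_pos.2 hst)] at h1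
  -- The right side is the difference quotient of `t (7x² - 2x + 4) + 2 t² (56x² + 20x + 23)` with
  -- `t + s` replaced by its lower bound `1`.
  have h3 : 8 * |6 * (t ^ 2 + s * t + s ^ 2) * (x - 1) ^ 2 - (2 * x + 1) ^ 2|
      < 119 * x ^ 2 + 38 * x + 50 := by
    have hq : t ^ 2 + s * t + s ^ 2 ≤ 3 := by nlinarith
    have hq0 : 0 ≤ t ^ 2 + s * t + s ^ 2 := by positivity
    have hl := mul_le_mul_of_nonneg_right hq (sq_nonneg (x - 1))
    have hl0 := mul_nonneg hq0 (sq_nonneg (x - 1))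
    have hb : |6 * (t ^ 2 + s * t + s ^ 2) * (x - 1) ^ 2 - (2 * x + 1) ^ 2|
        < (119 * x ^ 2 + 38 * x + 50) / 8 := by
      rw [abs_lt]
      constructor <;> nlinarith
    linarith
  have h4 : 119 * x ^ 2 + 38 * x + 50
      ≤ (7 * x ^ 2 - 2 * x + 4) + 2 * (t + s) * (56 * x ^ 2 + 20 * x + 23) := by
    have : 0 ≤ (t + s - 1) * (56 * x ^ 2 + 20 * x + 23) :=
      mul_nonneg (by linarith) (by positivity)
    linarith
  have h5 := mul_lt_mul_of_pos_left (h3.trans_le h4) (sub_pos.2 hst)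
  simp only [gap]
  linarith

lemma gap_one_pos {x : ℝ} (hx : 1 ≤ x) : 0 < gap x 1 := by
  have : |6 * 1 ^ 2 * (x - 1) ^ 2 - (2 * x + 1) ^ 2|
      < (103 * x ^ 2 + 22 * x + 46) / 8 := by
    rw [abs_lt]
    constructor <;> nlinarith
  rw [gap]
  generalize |6 * 1 ^ 2 * (x - 1) ^ 2 - (2 * x + 1) ^ 2| = A at this ⊢
  linarith

/-- Replacing `|A|` by `-A` bounds the value above by exactly `(11 x² - 70 x + 23) / 2`. -/
lemma gap_half_neg {x : ℝ} (h : 11 * x ^ 2 - 70 * x + 23 < 0) : gap x (1 / 2) < 0 := by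
  have := neg_le_abs (6 * (1 / 2 : ℝ) ^ 2 * (x - 1) ^ 2 - (2 * x + 1) ^ 2)
  simp only [gap]
  linarith

/-- Otherwise the modulus opens with a plus sign, and its cubic part `48 t³ (x - 1)²` is less than
the `112 t² x²` already in `gap`, which would be positive. This removes the modulus in `phiTwo`. -/
lemma sq_le_of_gap_nonpos {x t : ℝ} (hx : 1 ≤ x) (ht : 1 / 2 < t) (ht1 : t < 1)
    (h : gap x t ≤ 0) : 6 * t ^ 2 * (x - 1) ^ 2 ≤ (2 * x + 1) ^ 2 := by
  by_contra! hlt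
  rw [gap, abs_of_pos (sub_pos.2 hlt)] at h
  have h1 : 0 ≤ (1 - t) * (t ^ 2 * (x - 1) ^ 2) := mul_nonneg (by linarith) (by positivity)
  have h2 : 0 ≤ (t - 1 / 2) * (2 * x + 1) ^ 2 := mul_nonneg (by linarith) (by positivity)
  have h3 : 0 ≤ t ^ 2 * (2 * x - 1) := mul_nonneg (by positivity) (by linarith)
  have h4 : 0 < t * (7 * x ^ 2 - 2 * x + 4) := mul_pos (by linarith) (by nlinarith)
  have h5 : 0 ≤ t ^ 2 * x ^ 2 := by positivity
  have h6 : 0 ≤ t ^ 2 * x := mul_nonneg (by positivity) (by linarith)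
  have h7 : 0 ≤ t ^ 2 := by positivity
  nlinarith

/-! ### Bounding the Hankel determinant -/

/-- The real majorant of `P D² |a₂ a₄ - a₃²|`, as a quadratic polynomial in `u = |c|²`. -/
lemma majorant_le {t D P κ K p q X Y : ℝ} (ht : 1 / 2 < t) (hD : D ≤ 4 * P) (hD0 : 0 ≤ D)
    (hκ : 0 ≤ κ) (hp : 0 ≤ p) (hp1 : p ≤ 1) (hq : q = 1 - p ^ 2) (hX : 0 ≤ X) (hX1 : X ≤ 1)
    (hY : 0 ≤ Y) (hY1 : Y ≤ 1) :
    8 * t ^ 2 * K * p ^ 4 + 3 * t ^ 3 * κ * (p ^ 2 * q * (X + Y))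
      + 2 * t * (4 * t ^ 2 - 1) * D * (p ^ 2 * q * (X + Y))
      + 2 * t ^ 2 * D * (p * q * (2 - X ^ 2 - Y ^ 2))
      + 2 * t ^ 2 * D * (q * p ^ 2 * (X ^ 2 + Y ^ 2)) + 9 / 4 * P * t ^ 2 * (q ^ 2 * (X + Y) ^ 2)
    ≤ 8 * t ^ 2 * K * (p ^ 2) ^ 2
      + (6 * t ^ 3 * κ + 4 * t * (4 * t ^ 2 - 1) * D + 4 * t ^ 2 * D) * (p ^ 2 * (1 - p ^ 2))
      + 9 * P * t ^ 2 * (1 - p ^ 2) ^ 2 := by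
  have hq0 : 0 ≤ q := by rw [hq]; nlinarith
  have hS : 0 ≤ 2 - (X + Y) := by linarith
  have ht0 : 0 < t := by linarith
  have hU : 0 ≤ 4 * t ^ 2 - 1 := by nlinarith
  have g1 : 0 ≤ 3 * t ^ 3 * κ * (p ^ 2 * q * (2 - (X + Y))) := by positivity
  have g2 : 0 ≤ 2 * t * (4 * t ^ 2 - 1) * D * (p ^ 2 * q * (2 - (X + Y))) := by positivity
  have hp' : 0 ≤ 1 - p := by linarith
  -- Writing `2 (X² + Y²) = (X + Y)² + (X - Y)²`, the right side minus the left side is exactly `g1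
  -- + g2 + g3 + g4`. In `g4`, `D ≤ 4 P` and `p ≤ 1` give `D p ≤ 4 P p ≤ 9/4 P (1 + p)`.
  have g3 : 0 ≤ t ^ 2 * q * (D * p * (1 - p)) * (X - Y) ^ 2 := by positivity
  have h4 : 0 ≤ 9 / 4 * P * (1 + p) - D * p := by nlinarith
  have h5 : 0 ≤ 4 - (X + Y) ^ 2 := by nlinarith
  have g4 : 0 ≤ t ^ 2 * q * ((1 - p) * (4 - (X + Y) ^ 2)) * (9 / 4 * P * (1 + p) - D * p) := by
    positivity
  subst hq
  linarith

lemma norm_ofReal_mul_le {r m : ℝ} {z : ℂ} (hr : 0 ≤ r) (hz : ‖z‖ ≤ m) :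
    ‖(r : ℂ) * z‖ ≤ r * m := by
  rw [norm_mul, Complex.norm_real, Real.norm_of_nonneg hr]
  exact mul_le_mul_of_nonneg_left hz hr

/-- The bound for the Hankel determinant as a quadratic polynomial in `u = |c|²`. -/
lemma hankel_le {δ t : ℝ} (hδ : 1 ≤ δ) (ht : 1 / 2 < t) {f : ℂ → ℂ} (hf : ClassA f)
    (hs : BiStarlike t (hadamard f (fDelta δ))) :
    ∃ u : ℝ, 0 ≤ u ∧ u ≤ 1 ∧
      δ ^ 2 * (δ ^ 2 + 2) * (2 * δ ^ 2 + 1) ^ 2 *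
        ‖coeff f 2 * coeff f 4 - coeff f 3 ^ 2‖
      ≤ 9 * (δ ^ 2 * (δ ^ 2 + 2)) * t ^ 2
        + 2 * t * nabla (-2) (-1) 1 (-2) 10 1 23 20 56 δ t * u - t * gap (δ ^ 2) t * u ^ 2 := by
  have hδ0 : δ ≠ 0 := by linarith
  have ht0 : 0 < t := by linarith
  obtain ⟨b2, b3, b4⟩ := coeff_fDelta hδ0
  obtain ⟨c, x, y, s, s', q, hq, hc, hx, hy, hs1, hs2, A2, A3, A4⟩ := exists_parameters ht0.ne' hs
  have hfd := differentiableOn_fDelta hδ0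
  rw [A2, A3] at A4
  rw [coeff_hadamard hf.diff hfd] at A2 A3 A4
  rw [b2] at A2
  rw [b3] at A3
  rw [b4] at A4
  have hcc : c * conj c = (‖c‖ : ℂ) ^ 2 := Complex.mul_conj' c
  set P := δ ^ 2 * (δ ^ 2 + 2) with hP
  set D := (2 * δ ^ 2 + 1) ^ 2 with hD
  set K := 6 * t ^ 2 * (δ ^ 2 - 1) ^ 2 - D with hK
  have hδ2 : 1 ≤ δ ^ 2 := one_le_pow₀ hδ
  have hP0 : 0 ≤ P := by positivity
  have hD0 : 0 ≤ D := by positivity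
  have hDP : D ≤ 4 * P := by simp only [hD, hP]; nlinarith
  -- In full, `5 D - 12 P = 8 δ⁴ - 4 δ² + 5`, the factor appearing in `χ₁`.
  have hκ : 0 ≤ 5 * D - 12 * P := by simp only [hD, hP]; nlinarith [sq_nonneg (δ ^ 2 - 1)]
  have hq0 : 0 ≤ q := by rw [hq]; nlinarith [norm_nonneg c]
  have hU : 0 ≤ 4 * t ^ 2 - 1 := by nlinarith
  -- Expansion of `3 D A₂ A₄ - 9 P A₃²`, where `Aₙ = aₙ bₙ` are the coefficients of the convolution.
  have key : ((P * D : ℝ) : ℂ) * (coeff f 2 * coeff f 4 - coeff f 3 ^ 2)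
      = ((8 * t ^ 2 * K : ℝ) : ℂ) * c ^ 4
        + ((3 * t ^ 3 * (5 * D - 12 * P) : ℝ) : ℂ) * (c ^ 2 * q * (x - y))
        + ((2 * t * (4 * t ^ 2 - 1) * D : ℝ) : ℂ) * (c ^ 2 * q * (x + y))
        + ((2 * t ^ 2 * D : ℝ) : ℂ) * (c * q * (s - s'))
        - ((2 * t ^ 2 * D : ℝ) : ℂ) * (q * ‖c‖ ^ 2 * (x ^ 2 + y ^ 2))
        - ((9 / 4 * P * t ^ 2 : ℝ) : ℂ) * (q ^ 2 * (x - y) ^ 2) := by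
    simp only [hK, hD, hP]
    push_cast
    linear_combination
      (2 * (δ : ℂ) ^ 2 + 1) ^ 2 * (coeff f 4 * (δ ^ 3 + 2 * δ)) * A2
      + (2 * (δ : ℂ) ^ 2 + 1) ^ 2 * t * c * A4
      - 9 * ((δ : ℂ) ^ 2 * (δ ^ 2 + 2)) * (coeff f 3 * ((2 * δ ^ 2 + 1) / 3)
        + (4 * t ^ 2 * c ^ 2 + t / 2 * (q * (x - y)))) * A3
      - 2 * t ^ 2 * (2 * (δ : ℂ) ^ 2 + 1) ^ 2 * q * (x ^ 2 + y ^ 2) * hcc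
  have hnq : ‖(q : ℂ)‖ = q := by rw [Complex.norm_real, Real.norm_of_nonneg hq0]
  have n1 : ‖((8 * t ^ 2 * K : ℝ) : ℂ) * c ^ 4‖ = 8 * t ^ 2 * |K| * ‖c‖ ^ 4 := by
    rw [norm_mul, Complex.norm_real, Real.norm_eq_abs, abs_mul,
      abs_of_nonneg (show 0 ≤ 8 * t ^ 2 by positivity), norm_pow]
  have n2 : ‖((3 * t ^ 3 * (5 * D - 12 * P) : ℝ) : ℂ) * (c ^ 2 * q * (x - y))‖
      ≤ 3 * t ^ 3 * (5 * D - 12 * P) * (‖c‖ ^ 2 * q * (‖x‖ + ‖y‖)) :=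
    norm_ofReal_mul_le (by positivity) (by
      rw [norm_mul, norm_mul, norm_pow, hnq]; gcongr; exact norm_sub_le _ _)
  have n3 : ‖((2 * t * (4 * t ^ 2 - 1) * D : ℝ) : ℂ) * (c ^ 2 * q * (x + y))‖
      ≤ 2 * t * (4 * t ^ 2 - 1) * D * (‖c‖ ^ 2 * q * (‖x‖ + ‖y‖)) :=
    norm_ofReal_mul_le (by positivity) (by
      rw [norm_mul, norm_mul, norm_pow, hnq]; gcongr; exact norm_add_le _ _)
  have n4 : ‖((2 * t ^ 2 * D : ℝ) : ℂ) * (c * q * (s - s'))‖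
      ≤ 2 * t ^ 2 * D * (‖c‖ * q * (2 - ‖x‖ ^ 2 - ‖y‖ ^ 2)) :=
    norm_ofReal_mul_le (by positivity) (by
      rw [norm_mul, norm_mul, hnq]; gcongr; linarith [norm_sub_le s s'])
  have n5 : ‖((2 * t ^ 2 * D : ℝ) : ℂ) * (q * ‖c‖ ^ 2 * (x ^ 2 + y ^ 2))‖
      ≤ 2 * t ^ 2 * D * (q * ‖c‖ ^ 2 * (‖x‖ ^ 2 + ‖y‖ ^ 2)) :=
    norm_ofReal_mul_le (by positivity) (by
      rw [norm_mul, norm_mul, hnq, norm_pow, Complex.norm_real, norm_norm, ← norm_pow x,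
        ← norm_pow y]
      gcongr
      exact norm_add_le _ _)
  have n6 : ‖((9 / 4 * P * t ^ 2 : ℝ) : ℂ) * (q ^ 2 * (x - y) ^ 2)‖
      ≤ 9 / 4 * P * t ^ 2 * (q ^ 2 * (‖x‖ + ‖y‖) ^ 2) :=
    norm_ofReal_mul_le (by positivity) (by
      rw [norm_mul, norm_pow, norm_pow, hnq]; gcongr; exact norm_sub_le _ _)
  have hm := majorant_le (K := |K|) ht hDP hD0 hκ (norm_nonneg c) hc hq (norm_nonneg x) hx
    (norm_nonneg y) hy
  refine ⟨‖c‖ ^ 2, by positivity, pow_le_one₀ (norm_nonneg c) hc, ?_⟩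
  have hnorm : P * D * ‖coeff f 2 * coeff f 4 - coeff f 3 ^ 2‖
      = ‖((P * D : ℝ) : ℂ) * (coeff f 2 * coeff f 4 - coeff f 3 ^ 2)‖ := by
    rw [norm_mul, Complex.norm_real, Real.norm_of_nonneg (by positivity)]
  have htri : ∀ a b c d e g : ℂ, ‖a + b + c + d - e - g‖
      ≤ ‖a‖ + ‖b‖ + ‖c‖ + ‖d‖ + ‖e‖ + ‖g‖ := fun a b c d e g => by
    linarith [norm_sub_le (a + b + c + d - e) g, norm_sub_le (a + b + c + d) e,
      norm_add_le (a + b + c) d, norm_add_le (a + b) c, norm_add_le a b]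
  rw [hnorm, key]
  refine (htri _ _ _ _ _ _).trans (le_trans ?_ (hm.trans (le_of_eq ?_)))
  · linarith
  · rw [gap, ← hD, ← hK]
    generalize |K| = A
    simp only [nabla, hD, hP]
    ring

lemma phi_denominator_pos {δ : ℝ} (hδ : 1 ≤ δ) :
    0 < δ ^ 2 * (δ ^ 2 + 2) * (2 * δ ^ 2 + 1) ^ 2 := by positivity

/-- For a concave quadratic the vertex value bounds it at every real `u`, so the location of the
vertex relative to `[0, 1]` is irrelevant. -/
lemma hankel_le_phiCrit {δ t : ℝ} (hδ : 1 ≤ δ) (ht : 1 / 2 < t) (hg : 0 < gap (δ ^ 2) t)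
    {f : ℂ → ℂ} (hf : ClassA f) (hs : BiStarlike t (hadamard f (fDelta δ))) :
    ‖coeff f 2 * coeff f 4 - coeff f 3 ^ 2‖ ≤ phiCrit δ t := by
  obtain ⟨u, -, -, h⟩ := hankel_le hδ ht hf hs
  have hpos := phi_denominator_pos hδ
  have hδ0 : 0 < δ := by linarith
  have hgap : nabla (-4) 1 2 4 (-2) 7 23 20 56 δ t
      - 8 * t * |6 * t ^ 2 * (δ ^ 2 - 1) ^ 2 - (2 * δ ^ 2 + 1) ^ 2| = gap (δ ^ 2) t := by
    simp only [nabla, gap]; ring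
  set N := nabla (-2) (-1) 1 (-2) 10 1 23 20 56 δ t with hN
  refine le_of_mul_le_mul_left (h.trans ?_) hpos
  rw [phiCrit, hgap, ← hN]
  set G := gap (δ ^ 2) t
  have e : δ ^ 2 * (δ ^ 2 + 2) * (2 * δ ^ 2 + 1) ^ 2 * (9 * t ^ 2 / (2 * δ ^ 2 + 1) ^ 2
      + t * N ^ 2 / (δ * (2 * δ ^ 2 + 1) ^ 2 * (δ ^ 3 + 2 * δ) * G))
      = 9 * (δ ^ 2 * (δ ^ 2 + 2)) * t ^ 2 + t * N ^ 2 / G := by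
    have : δ ^ 3 + 2 * δ = δ * (δ ^ 2 + 2) := by ring
    rw [this]
    field_simp
  rw [e]
  have e2 : t * N ^ 2 / G - (2 * t * N * u - t * G * u ^ 2) = t * (N - G * u) ^ 2 / G := by
    field_simp; ring
  have : 0 ≤ t * (N - G * u) ^ 2 / G := by positivity
  linarith

lemma hankel_le_phiTwo {δ t : ℝ} (hδ : 1 ≤ δ) (ht : 1 / 2 < t) (ht1 : t < 1)
    (hg : gap (δ ^ 2) t ≤ 0) {f : ℂ → ℂ} (hf : ClassA f)
    (hs : BiStarlike t (hadamard f (fDelta δ))) :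
    ‖coeff f 2 * coeff f 4 - coeff f 3 ^ 2‖ ≤ phiTwo δ t := by
  obtain ⟨u, hu0, hu1, h⟩ := hankel_le hδ ht hf hs
  have hpos := phi_denominator_pos hδ
  have hδ0 : 0 < δ := by linarith
  have hδ2 : 1 ≤ δ ^ 2 := one_le_pow₀ hδ
  have hK := sq_le_of_gap_nonpos hδ2 ht ht1 hg
  have hN : 0 ≤ nabla (-2) (-1) 1 (-2) 10 1 23 20 56 δ t := by
    have h1 : 0 ≤ (2 * t - 1) * (δ ^ 4 + 10 * δ ^ 2) := mul_nonneg (by linarith) (by positivity)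
    have h2 : 0 ≤ (2 * t - 1) * (2 * t + 1) * (56 * δ ^ 4 + 20 * δ ^ 2 + 23) :=
      mul_nonneg (mul_nonneg (by linarith) (by linarith)) (by positivity)
    have h3 : 0 ≤ (2 * t - 1) * (2 * t - 1) * (56 * δ ^ 4 + 20 * δ ^ 2 + 23) :=
      mul_nonneg (mul_self_nonneg _) (by positivity)
    simp only [nabla]
    nlinarith [sq_nonneg (δ ^ 2 - 1)]
  refine le_of_mul_le_mul_left (h.trans ?_) hpos
  -- At `u = 1` only the `c⁴` term of the majorant survives, so the value is `8 t² |K|` with `K = 6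
  -- t² (δ² - 1)² - D`, and here `K ≤ 0`.
  have e : δ ^ 2 * (δ ^ 2 + 2) * (2 * δ ^ 2 + 1) ^ 2 * phiTwo δ t
      = 9 * (δ ^ 2 * (δ ^ 2 + 2)) * t ^ 2
        + 2 * t * nabla (-2) (-1) 1 (-2) 10 1 23 20 56 δ t - t * gap (δ ^ 2) t := by
    have h1 : (2 * δ ^ 3 + δ) = δ * (2 * δ ^ 2 + 1) := by ring
    have h2 : δ ^ 2 * (δ ^ 2 + 2) * (2 * δ ^ 2 + 1) ^ 2 * phiTwo δ t
        = 8 * t ^ 2 * ((2 * δ ^ 2 + 1) ^ 2 - 6 * t ^ 2 * (δ ^ 2 - 1) ^ 2) := by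
      rw [phiTwo, h1]; field_simp
    rw [h2, gap, abs_of_nonpos (sub_nonpos.2 hK)]
    simp only [nabla]
    ring
  rw [e]
  have ht0 : 0 < t := by linarith
  have h1 : 0 ≤ 2 * t * nabla (-2) (-1) 1 (-2) 10 1 23 20 56 δ t * (1 - u) :=
    mul_nonneg (by positivity) (by linarith)
  have h2 : 0 ≤ t * (-gap (δ ^ 2) t) * (1 - u ^ 2) :=
    mul_nonneg (mul_nonneg ht0.le (by linarith)) (by nlinarith)
  linarith

lemma chi1_eq_zero_iff (δ : ℝ) {t : ℝ} (ht : 0 < t) :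
    chi1 1 0 δ t = 0 ↔ gap (δ ^ 2) t = 0 := by
  rw [chi1_eq δ ht]
  simp [ht.ne']

end BiUniv

theorem corollary5 (δ : ℝ) (hδ : 1 ≤ δ) :
    (11 * δ ^ 4 - 70 * δ ^ 2 + 23 < 0 →
      ∃! t₀ : ℝ, t₀ ∈ Set.Ioo (1 / 2 : ℝ) 1 ∧ BiUniv.chi1 1 0 δ t₀ = 0) ∧
    ∀ t ∈ Set.Ioo (1 / 2 : ℝ) 1, ∀ f : ℂ → ℂ, BiUniv.ClassA f →
      BiUniv.BiStarlike t (BiUniv.hadamard f (BiUniv.fDelta δ)) →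
      (∀ t₀ ∈ Set.Ioo (1 / 2 : ℝ) 1, BiUniv.chi1 1 0 δ t₀ = 0 →
        (t ≤ t₀ →
          ‖BiUniv.coeff f 2 * BiUniv.coeff f 4 - BiUniv.coeff f 3 ^ 2‖ ≤ BiUniv.phiTwo δ t) ∧
        (t₀ < t →
          ‖BiUniv.coeff f 2 * BiUniv.coeff f 4 - BiUniv.coeff f 3 ^ 2‖ ≤ BiUniv.phiCrit δ t)) ∧
      ((∀ t₀ ∈ Set.Ioo (1 / 2 : ℝ) 1, BiUniv.chi1 1 0 δ t₀ ≠ 0) →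
        ‖BiUniv.coeff f 2 * BiUniv.coeff f 4 - BiUniv.coeff f 3 ^ 2‖ ≤ BiUniv.phiCrit δ t) := by
  have hδ2 : 1 ≤ δ ^ 2 := one_le_pow₀ hδ
  have hpos : ∀ t ∈ Set.Ioo (1 / 2 : ℝ) 1, 0 < t := fun t ht => by linarith [ht.1]
  have hcont := BiUniv.continuous_gap (δ ^ 2)
  refine ⟨fun h => ?_, fun t ht f hf hs => ⟨fun t₀ ht₀ hroot => ⟨fun hle => ?_, fun hlt => ?_⟩,
    fun hno => ?_⟩⟩
  · have hneg : BiUniv.gap (δ ^ 2) (1 / 2) < 0 := BiUniv.gap_half_neg (by linarith)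
    obtain ⟨r, hr, hr0⟩ := intermediate_value_Ioo (by norm_num) hcont.continuousOn
      ⟨hneg, BiUniv.gap_one_pos hδ2⟩
    refine ⟨r, ⟨hr, (BiUniv.chi1_eq_zero_iff δ (hpos r hr)).2 hr0⟩, fun r' ⟨hr', h'⟩ => ?_⟩
    rw [BiUniv.chi1_eq_zero_iff δ (hpos r' hr')] at h'
    rcases lt_trichotomy r' r with hlt | heq | hlt
    · linarith [BiUniv.gap_lt_gap hδ2 hr'.1.le hlt hr.2.le]
    · exact heq
    · linarith [BiUniv.gap_lt_gap hδ2 hr.1.le hlt hr'.2.le]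
  · rw [BiUniv.chi1_eq_zero_iff δ (hpos t₀ ht₀)] at hroot
    refine BiUniv.hankel_le_phiTwo hδ ht.1 ht.2 ?_ hf hs
    rcases hle.lt_or_eq with hlt | rfl
    · linarith [BiUniv.gap_lt_gap hδ2 ht.1.le hlt ht₀.2.le]
    · exact hroot.le
  · rw [BiUniv.chi1_eq_zero_iff δ (hpos t₀ ht₀)] at hroot
    refine BiUniv.hankel_le_phiCrit hδ ht.1 ?_ hf hs
    linarith [BiUniv.gap_lt_gap hδ2 ht₀.1.le hlt ht.2.le]
  · refine BiUniv.hankel_le_phiCrit hδ ht.1 ?_ hf hs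
    -- A nonpositive value at `t` produces a root: `t` itself if it vanishes, otherwise a point of
    -- `(t, 1)`, because `gap` is positive at `1`.
    by_contra hneg
    have hlt : BiUniv.gap (δ ^ 2) t < 0 := lt_of_le_of_ne (not_lt.1 hneg) fun h =>
      hno t ht ((BiUniv.chi1_eq_zero_iff δ (hpos t ht)).2 h)
    obtain ⟨r, hr, hr0⟩ := intermediate_value_Ioo ht.2.le hcont.continuousOn
      ⟨hlt, BiUniv.gap_one_pos hδ2⟩
    have hr' : r ∈ Set.Ioo (1 / 2 : ℝ) 1 := ⟨ht.1.trans hr.1, hr.2⟩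
    exact hno r hr' ((BiUniv.chi1_eq_zero_iff δ (hpos r hr')).2 hr0)
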